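/- Let $G$ be a finite group of order $n$ and let $V$ be a simple $\mathbb{C}[G]$-module of dimension $d$; define $e$ by $n = d(d+e)$. Assume that there is a normal subgroup $N \neq \{1\}$ of $G$ that acts trivially on every simple $\mathbb{C}[G]$-module not isomorphic to $V$. Suppose that $e > 1$ and that $e$ is not a power of $2$. Then there are an odd prime $p$, a positive integer $k$ and a non-negative integer $m$ such that $|N| = p^k$ and $e = p^m$ (these conditions determine $p$, $k$ and $m$ uniquely), and one has $$k < 2m,$$ or equivalently $|N| < e^2$. -/

import Mathlib

universe u v

/-- The subgroup `N` acts trivially on every simple `ℂ[G]`-module that is not isomorphic to `V`.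
The simple modules range over the universe of `G`; every simple `ℂ[G]`-module, being a quotient of
`ℂ[G]`, is isomorphic to one of these. -/
def ActsTriviallyOnOtherSimples {G : Type u} [Group G] (N : Subgroup G)
    (V : Type v) [AddCommGroup V] [Module (MonoidAlgebra ℂ G) V] : Prop :=
  ∀ (W : Type u) [AddCommGroup W] [Module (MonoidAlgebra ℂ G) W]
    [IsSimpleModule (MonoidAlgebra ℂ G) W],
    ¬ Nonempty (W ≃ₗ[MonoidAlgebra ℂ G] V) →
      ∀ x ∈ N, ∀ w : W, MonoidAlgebra.of ℂ G x • w = w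

/-! Let ε be the average of N and q = |N|. All simple modules but V are fixed by N, and V has no
nonzero N-fixed vector, so the annihilator of V is ℂ[G]ε. Comparing dimensions gives eq = d + e,
hence |G| = (q - 1)e²q. A class sum acts on V as a scalar, so up to a multiple of 1 it lies in
ℂ[G]ε: nontrivial elements of one coset of N are conjugate (`CosetsConj`).

The rest is group theory. N is an elementary abelian p-group, and the centralizer of each nontrivial
x in N is a p-group of order e²q; so e = p^m, with p odd. If some g outside N centralizes N, then
C(g) ∩ C(N) has order p^j > q, and the class of g is a union of cosets of N, so q p^j divides (q -
1)p^(2m) q and k < j ≤ 2m. If C(N) ≤ N, an involution inverts N, which forces C(x) ≤ N, against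
|C(x)| = e²q > q. -/

section SubgroupAverage

/-! ### The averaging idempotent of a subgroup. -/

variable {G : Type*} [Group G]

/-- The average in `ℂ[G]` of the elements of a finite subgroup. -/
noncomputable def subgroupAverage (N : Subgroup G) [Fintype N] : MonoidAlgebra ℂ G :=
  (Nat.card N : ℂ)⁻¹ • ∑ x : N, MonoidAlgebra.of ℂ G x

variable (N : Subgroup G) [Fintype N]

theorem of_mul_subgroupAverage {x : G} (hx : x ∈ N) :
    MonoidAlgebra.of ℂ G x * subgroupAverage N = subgroupAverage N := by
  unfold subgroupAverage
  rw [mul_smul_comm, Finset.mul_sum]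
  congr 1
  refine Fintype.sum_equiv (Equiv.mulLeft (⟨x, hx⟩ : N)) _ _ fun y => ?_
  simp

theorem subgroupAverage_smul {V : Type*} [AddCommGroup V] [Module ℂ V]
    [Module (MonoidAlgebra ℂ G) V] [IsScalarTower ℂ (MonoidAlgebra ℂ G) V] {v : V}
    (h : ∀ x ∈ N, MonoidAlgebra.of ℂ G x • v = v) :
    subgroupAverage N • v = v := by
  have hq : (Nat.card N : ℂ) ≠ 0 := by simp
  unfold subgroupAverage
  rw [smul_assoc, Finset.sum_smul, Finset.sum_congr rfl fun (x : N) _ => h x x.2]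
  rw [Finset.sum_const, Finset.card_univ, ← Nat.card_eq_fintype_card, ← Nat.cast_smul_eq_nsmul ℂ,
    smul_smul, inv_mul_cancel₀ hq, one_smul]

theorem mul_of_eq_of_mul_subgroupAverage_eq {a : MonoidAlgebra ℂ G}
    (h : a * subgroupAverage N = a) {x : G} (hx : x ∈ N) : a * MonoidAlgebra.of ℂ G x = a := by
  rw [← h, mul_assoc]
  congr 1
  unfold subgroupAverage
  rw [smul_mul_assoc, Finset.sum_mul]
  congr 1
  refine Fintype.sum_equiv (Equiv.mulRight (⟨x, hx⟩ : N)) _ _ fun y => ?_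
  simp

theorem coeff_mul_right_of_mul_subgroupAverage_eq {a : MonoidAlgebra ℂ G}
    (h : a * subgroupAverage N = a) {x : G} (hx : x ∈ N) (g : G) :
    a.coeff (g * x) = a.coeff g := by
  conv_lhs => rw [← mul_of_eq_of_mul_subgroupAverage_eq N h hx]
  simp

theorem coeff_subgroupAverage_one : (subgroupAverage N).coeff 1 = (Nat.card N : ℂ)⁻¹ := by
  classical
  unfold subgroupAverage
  rw [MonoidAlgebra.coeff_smul_apply, MonoidAlgebra.coeff_sum, Finsupp.finsetSum_apply,
    Finset.sum_eq_single (1 : N)]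
  · simp
  · intro x _ hx
    simpa [Finsupp.single_apply] using hx
  · simp

/-- In the basis G every diagonal entry is the coefficient of g in g * a, that is, of 1 in a. -/
theorem trace_mulRight [Finite G] (a : MonoidAlgebra ℂ G) :
    LinearMap.trace ℂ _ (LinearMap.mulRight ℂ a) = Nat.card G * a.coeff 1 := by
  classical
  have := Fintype.ofFinite G
  let b : Module.Basis G ℂ (MonoidAlgebra ℂ G) := .ofRepr (MonoidAlgebra.coeffLinearEquiv ℂ)
  rw [LinearMap.trace_eq_matrix_trace ℂ b, Matrix.trace]
  have key (g : G) : Matrix.diag (LinearMap.toMatrix b b (LinearMap.mulRight ℂ a)) g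
      = a.coeff 1 := by
    rw [Matrix.diag_apply, LinearMap.toMatrix_apply]
    have hb : b g = MonoidAlgebra.single g 1 := by
      apply b.repr.injective
      rw [b.repr_self]
      rfl
    rw [hb]
    change (MonoidAlgebra.single g 1 * a).coeff g = _
    simp
  rw [Finset.sum_congr rfl fun g _ => key g]
  simp

end SubgroupAverage

/-! ### From the module hypothesis to conjugacy and a dimension count. -/

section OtherSimplesTrivial

variable {G : Type u} [Group G]

theorem eq_zero_of_forall_simple_submodule_smul_eq_zero [Finite G] {a : MonoidAlgebra ℂ G}
    (h : ∀ W : Submodule (MonoidAlgebra ℂ G) (MonoidAlgebra ℂ G),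
      IsSimpleModule (MonoidAlgebra ℂ G) W → ∀ w ∈ W, a * w = 0) : a = 0 := by
  have htop := IsSemisimpleModule.sSup_simples_eq_top (MonoidAlgebra ℂ G) (MonoidAlgebra ℂ G)
  have key : ∀ b ∈ sSup {m : Submodule (MonoidAlgebra ℂ G) (MonoidAlgebra ℂ G) |
      IsSimpleModule (MonoidAlgebra ℂ G) m}, a * b = 0 := by
    intro b hb
    rw [sSup_eq_iSup'] at hb
    induction hb using Submodule.iSup_induction' with
    | mem W w hw => exact h W W.2 w hw
    | zero => simp
    | add x y _ _ hx hy => rw [mul_add, hx, hy, add_zero]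
  simpa using key 1 (htop ▸ trivial)

variable {V : Type v} [AddCommGroup V] [Module (MonoidAlgebra ℂ G) V]

section

variable [Module ℂ V] [IsScalarTower ℂ (MonoidAlgebra ℂ G) V] [IsSimpleModule (MonoidAlgebra ℂ G) V]

theorem exists_smul_eq_of_commute [FiniteDimensional ℂ V] {z : MonoidAlgebra ℂ G}
    (hz : ∀ a, Commute z a) : ∃ c : ℂ, ∀ v : V, z • v = c • v := by
  have := IsSimpleModule.nontrivial (MonoidAlgebra ℂ G) V
  obtain ⟨c, hc⟩ := Module.End.exists_eigenvalue (Algebra.lsmul ℂ ℂ V z)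
  obtain ⟨v, hv, hv0⟩ := hc.exists_hasEigenvector
  rw [Module.End.mem_eigenspace_iff] at hv
  refine ⟨c, fun w => ?_⟩
  obtain ⟨a, rfl⟩ := IsSimpleModule.toSpanSingleton_surjective (MonoidAlgebra ℂ G) hv0 w
  rw [LinearMap.toSpanSingleton_apply, smul_smul, (hz a).eq, mul_smul]
  rw [show z • v = c • v from hv, smul_comm]

/-- Burnside's theorem: by Schur's lemma every ℂ-linear map commutes with the ℂ[G]-endomorphisms, so
Jacobson density, applied to a finite spanning set, realizes it. -/
theorem lsmul_surjective_of_isSimpleModule [FiniteDimensional ℂ V] :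
    Function.Surjective (Algebra.lsmul ℂ ℂ V : MonoidAlgebra ℂ G →ₐ[ℂ] Module.End ℂ V) := by
  have := IsSimpleModule.nontrivial (MonoidAlgebra ℂ G) V
  have hscalar (f : Module.End (MonoidAlgebra ℂ G) V) : ∃ c : ℂ, ∀ v, f v = c • v := by
    obtain ⟨c, hc⟩ := Module.End.exists_eigenvalue (f.restrictScalars ℂ)
    obtain ⟨v, hv, hv0⟩ := hc.exists_hasEigenvector
    rw [Module.End.mem_eigenspace_iff] at hv
    refine ⟨c, fun w => ?_⟩
    obtain ⟨a, rfl⟩ := IsSimpleModule.toSpanSingleton_surjective (MonoidAlgebra ℂ G) hv0 w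
    rw [LinearMap.toSpanSingleton_apply, map_smul, show f v = c • v from hv, smul_comm]
  intro φ
  let ψ : Module.End (Module.End (MonoidAlgebra ℂ G) V) V :=
    { φ with
      map_smul' := fun f v => by
        obtain ⟨c, hc⟩ := hscalar f
        simp [hc] }
  obtain ⟨s, hs⟩ := Module.Finite.fg_top (R := ℂ) (M := V)
  obtain ⟨a, ha⟩ := jacobson_density (R := MonoidAlgebra ℂ G) ψ s
  refine ⟨a, LinearMap.ext_on hs fun v hv => (ha v hv).symm⟩

end

variable {N : Subgroup G}

namespace ActsTriviallyOnOtherSimples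

theorem exists_smul_ne [Finite G] (hNV : ActsTriviallyOnOtherSimples N V) (hN : N ≠ ⊥) :
    ∃ x ∈ N, ∃ v : V, MonoidAlgebra.of ℂ G x • v ≠ v := by
  by_contra! hV
  refine hN ((Subgroup.eq_bot_iff_forall N).2 fun x hx => ?_)
  have h0 : MonoidAlgebra.of ℂ G x - 1 = 0 := by
    refine eq_zero_of_forall_simple_submodule_smul_eq_zero fun W hW w hw => ?_
    rw [sub_mul, one_mul, sub_eq_zero]
    by_cases hWV : Nonempty (W ≃ₗ[MonoidAlgebra ℂ G] V)
    · obtain ⟨f⟩ := hWV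
      have : MonoidAlgebra.of ℂ G x • (⟨w, hw⟩ : W) = ⟨w, hw⟩ := by
        apply f.injective
        rw [map_smul, hV x hx]
      exact congrArg Subtype.val this
    · exact congrArg Subtype.val (hNV W hWV x hx ⟨w, hw⟩)
  exact MonoidAlgebra.of_injective ((sub_eq_zero.1 h0).trans (map_one _).symm)

theorem mul_subgroupAverage_eq [Finite G] [N.Normal]
    [Fintype N] (hNV : ActsTriviallyOnOtherSimples N V) {a : MonoidAlgebra ℂ G}
    (ha : ∀ v : V, a • v = 0) : a * subgroupAverage N = a := by
  rw [← sub_eq_zero]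
  refine eq_zero_of_forall_simple_submodule_smul_eq_zero fun W hW w hw => ?_
  by_cases hWV : Nonempty (W ≃ₗ[MonoidAlgebra ℂ G] V)
  · obtain ⟨f⟩ := hWV
    have : (a * subgroupAverage N - a) • (⟨w, hw⟩ : W) = 0 := by
      apply f.injective
      rw [map_smul, sub_smul, mul_smul, ha, ha, sub_zero, map_zero]
    exact congrArg Subtype.val this
  · have : subgroupAverage N • (⟨w, hw⟩ : W) = ⟨w, hw⟩ :=
      subgroupAverage_smul N fun x hx => hNV W hWV x hx ⟨w, hw⟩
    rw [sub_mul, mul_assoc, show subgroupAverage N * w = w from congrArg Subtype.val this, sub_self]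

variable [Module ℂ V] [IsScalarTower ℂ (MonoidAlgebra ℂ G) V]

/-- As N is normal, its fixed vectors form a submodule; if nonzero it would be all of V, and N would
then act trivially on every simple module. -/
theorem eq_zero_of_forall_smul_eq [IsSimpleModule (MonoidAlgebra ℂ G) V] [Finite G] [hn : N.Normal]
    (hNV : ActsTriviallyOnOtherSimples N V) (hN : N ≠ ⊥) {v : V}
    (hv : ∀ x ∈ N, MonoidAlgebra.of ℂ G x • v = v) : v = 0 := by
  by_contra hv0
  obtain ⟨x, hx, w, hw⟩ := hNV.exists_smul_ne hN
  refine hw ?_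
  obtain ⟨a, ha⟩ := IsSimpleModule.toSpanSingleton_surjective (MonoidAlgebra ℂ G) hv0 w
  rw [← ha, LinearMap.toSpanSingleton_apply]
  clear hw ha w
  induction a using MonoidAlgebra.induction_on with
  | of g =>
    rw [smul_smul, ← map_mul, show x * g = g * (g⁻¹ * x * g) by group, map_mul, mul_smul,
      hv _ (by simpa using hn.conj_mem x hx g⁻¹)]
  | add a b ha hb => rw [add_smul, smul_add, ha, hb]
  | smul r a ha => rw [smul_assoc, smul_comm, ha]

theorem subgroupAverage_smul_eq_zero [IsSimpleModule (MonoidAlgebra ℂ G) V] [Finite G] [N.Normal]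
    [Fintype N] (hNV : ActsTriviallyOnOtherSimples N V) (hN : N ≠ ⊥) (v : V) :
    subgroupAverage N • v = 0 :=
  hNV.eq_zero_of_forall_smul_eq hN fun x hx => by rw [smul_smul, of_mul_subgroupAverage N hx]

/-- The class sum of g (with multiplicity) minus its scalar on V kills V, so its coefficients are
constant on cosets of N. Away from 1 these are those of the class sum. -/
theorem isConj_mul_right [IsSimpleModule (MonoidAlgebra ℂ G) V] [FiniteDimensional ℂ V] [Finite G]
    [N.Normal] (hNV : ActsTriviallyOnOtherSimples N V) {g x : G} (hg : g ≠ 1)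
    (hx : x ∈ N) (hgx : g * x ≠ 1) : IsConj g (g * x) := by
  classical
  have := Fintype.ofFinite G
  let z : MonoidAlgebra ℂ G := ∑ h : G, MonoidAlgebra.of ℂ G (h * g * h⁻¹)
  have hzcomm (h : G) : Commute z (MonoidAlgebra.of ℂ G h) := by
    simp only [z, Commute, SemiconjBy, Finset.sum_mul, Finset.mul_sum, ← map_mul]
    refine Fintype.sum_equiv (Equiv.mulLeft h⁻¹) _ _ fun y => ?_
    congr 1
    simp [mul_assoc]
  have hz (a : MonoidAlgebra ℂ G) : Commute z a := by
    induction a using MonoidAlgebra.induction_on with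
    | of h => exact hzcomm h
    | add a b ha hb => exact ha.add_right hb
    | smul r a ha => exact ha.smul_right r
  have hcoeff (y : G) : z.coeff y = (Finset.univ.filter fun h : G => h * g * h⁻¹ = y).card := by
    simp [z, MonoidAlgebra.coeff_sum, Finsupp.finsetSum_apply, Finsupp.single_apply,
      Finset.sum_boole]
  obtain ⟨c, hc⟩ := exists_smul_eq_of_commute (V := V) hz
  have hkill := hNV.mul_subgroupAverage_eq (a := z - c • 1) fun v => by
    rw [sub_smul, hc, smul_assoc, one_smul, sub_self]
  have key := coeff_mul_right_of_mul_subgroupAverage_eq N hkill hx g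
  have hone {y : G} (hy : y ≠ 1) : (z - c • 1).coeff y = z.coeff y := by
    simp [MonoidAlgebra.one_def, hy]
  rw [hone hg, hone hgx, hcoeff, hcoeff, Nat.cast_inj] at key
  have hpos : 0 < (Finset.univ.filter fun h : G => h * g * h⁻¹ = g).card :=
    Finset.card_pos.2 ⟨1, by simp⟩
  rw [← key] at hpos
  obtain ⟨h, hh⟩ := Finset.card_pos.1 hpos
  exact isConj_iff.2 ⟨h, by simpa using hh⟩

/-- Right multiplication by ε projects onto the annihilator of V, so its trace |G|/|N| is the
dimension |G| - d² of that annihilator. -/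
theorem card_mul_eq [IsSimpleModule (MonoidAlgebra ℂ G) V] [FiniteDimensional ℂ V] [Finite G]
    [N.Normal] (hNV : ActsTriviallyOnOtherSimples N V) (hN : N ≠ ⊥) :
    Nat.card G * Nat.card N = Module.finrank ℂ V ^ 2 * Nat.card N + Nat.card G := by
  have := Fintype.ofFinite N
  have hfin : Module.Finite ℂ (MonoidAlgebra ℂ G) := inferInstance
  let L : MonoidAlgebra ℂ G →ₗ[ℂ] Module.End ℂ V := (Algebra.lsmul ℂ ℂ V).toLinearMap
  have hproj : LinearMap.IsProj (LinearMap.ker L) (LinearMap.mulRight ℂ (subgroupAverage N)) := by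
    refine ⟨fun a => LinearMap.ext fun v => ?_, fun a ha => ?_⟩
    · change (a * subgroupAverage N) • v = 0
      rw [mul_smul, hNV.subgroupAverage_smul_eq_zero hN, smul_zero]
    · exact hNV.mul_subgroupAverage_eq fun v => LinearMap.congr_fun ha v
  have htr := hproj.trace
  rw [trace_mulRight, coeff_subgroupAverage_one] at htr
  have hrank := L.finrank_range_add_finrank_ker
  rw [LinearMap.range_eq_top.2 lsmul_surjective_of_isSimpleModule, finrank_top,
    Module.finrank_linearMap, ← sq] at hrank
  have hG : Module.finrank ℂ (MonoidAlgebra ℂ G) = Nat.card G := by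
    have := Fintype.ofFinite G
    rw [(MonoidAlgebra.coeffLinearEquiv ℂ).finrank_eq, Module.finrank_finsupp_self,
      Nat.card_eq_fintype_card]
  rw [hG] at hrank
  have hq : (Nat.card N : ℂ) ≠ 0 := by simp
  have hker : Nat.card G = Module.finrank ℂ (LinearMap.ker L) * Nat.card N := by
    rw [← div_eq_mul_inv, div_eq_iff hq] at htr
    exact_mod_cast htr
  nth_rw 1 [← hrank]
  rw [add_mul, ← hker]

end ActsTriviallyOnOtherSimples

end OtherSimplesTrivial

/-! ### Groups in which cosets of N are conjugate. -/

section IsConjMulRight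

variable {G : Type*} [Group G]

theorem card_isConj_mul_card_centralizer [Finite G] (g : G) :
    Nat.card {y : G | IsConj g y} * Nat.card (Subgroup.centralizer {g}) = Nat.card G := by
  rw [Subgroup.nat_card_centralizer_nat_card_stabilizer]
  have h : {y : G | IsConj g y} = MulAction.orbit (ConjAct G) g := by
    ext y
    rw [ConjAct.mem_orbit_conjAct]
    exact isConj_comm
  rw [h, ← Nat.card_prod]
  exact Nat.card_congr (MulAction.orbitProdStabilizerEquivGroup (ConjAct G) g)

theorem card_dvd_card_of_forall_mul_mem [Finite G] {N : Subgroup G} {S : Set G}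
    (hS : ∀ g ∈ S, ∀ x ∈ N, g * x ∈ S) : Nat.card N ∣ Nat.card S := by
  have h : QuotientGroup.mk ⁻¹' ((QuotientGroup.mk : G → G ⧸ N) '' S) = S := by
    refine (Set.subset_preimage_image _ _).antisymm' ?_
    rintro g ⟨s, hs, hsg⟩
    rw [QuotientGroup.eq] at hsg
    simpa using hS s hs _ hsg
  rw [← h, QuotientGroup.card_preimage_mk]
  exact dvd_mul_right _ _

/-- Any two nontrivial elements of a common left coset of `N` are conjugate in `G`. -/
def CosetsConj (N : Subgroup G) : Prop :=
  ∀ ⦃g x : G⦄, g ≠ 1 → x ∈ N → g * x ≠ 1 → IsConj g (g * x)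

variable {N : Subgroup G}

namespace CosetsConj

theorem isConj_of_mem (hc : CosetsConj N) {x y : G} (hx : x ∈ N) (hy : y ∈ N) (hx1 : x ≠ 1)
    (hy1 : y ≠ 1) :
    IsConj x y := by
  simpa using hc hx1 (N.mul_mem (N.inv_mem hx) hy) (by simpa using hy1)

theorem isConj_mul_of_notMem (hc : CosetsConj N) {g x : G} (hg : g ∉ N) (hx : x ∈ N) :
    IsConj g (g * x) := by
  refine hc (fun h => hg (h ▸ N.one_mem)) hx fun h => hg ?_
  rw [eq_inv_of_mul_eq_one_left h]
  exact N.inv_mem hx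

theorem exists_prime_forall_pow_eq_one [Finite G] (hc : CosetsConj N) (hN : N ≠ ⊥) :
    ∃ p : ℕ, p.Prime ∧ ∀ x ∈ N, x ^ p = 1 := by
  have hcard : Nat.card N ≠ 1 := fun h => hN (Subgroup.card_eq_one.1 h)
  obtain ⟨p, hp, hpN⟩ := Nat.exists_prime_and_dvd hcard
  have := Fact.mk hp
  obtain ⟨z, hz⟩ := exists_prime_orderOf_dvd_card' p hpN
  refine ⟨p, hp, fun x hx => ?_⟩
  by_cases hx1 : x = 1
  · simp [hx1]
  have hz1 : (z : G) ≠ 1 := fun h => by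
    rw [← Subgroup.orderOf_coe, h, orderOf_one] at hz
    exact hp.one_lt.ne hz
  obtain ⟨h, rfl⟩ := isConj_iff.1 (hc.isConj_of_mem z.2 hx hz1 hx1)
  rw [conj_pow, ← hz, ← Subgroup.orderOf_coe, pow_orderOf_eq_one]
  simp

/-- The centre of N is nontrivial, and conjugation in G carries a nontrivial central element to any
other nontrivial element of N. -/
theorem le_centralizer_of_isPGroup [Finite G] [N.Normal] (hc : CosetsConj N) (hN : N ≠ ⊥)
    {p : ℕ} [Fact p.Prime]
    (hp : IsPGroup p N) : N ≤ Subgroup.centralizer N := by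
  have : Nontrivial N := (Subgroup.nontrivial_iff_ne_bot N).2 hN
  have hnt := hp.center_nontrivial
  obtain ⟨⟨z, hz⟩, hz1⟩ := exists_ne (1 : Subgroup.center N)
  intro x hx
  by_cases hx1 : x = 1
  · exact hx1 ▸ Subgroup.one_mem _
  have hz1' : (z : G) ≠ 1 := fun h => hz1 (by ext; exact h)
  obtain ⟨h, rfl⟩ := isConj_iff.1 (hc.isConj_of_mem z.2 hx hz1' hx1)
  rw [Subgroup.mem_centralizer_iff]
  intro y hy
  have hy' : h⁻¹ * y * h ∈ N := by simpa using Subgroup.Normal.conj_mem ‹_› y hy h⁻¹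
  have hcomm := congrArg Subtype.val (Subgroup.mem_center_iff.1 hz ⟨_, hy'⟩)
  simp only [Subgroup.coe_mul] at hcomm
  calc y * (h * z * h⁻¹) = h * (h⁻¹ * y * h * z) * h⁻¹ := by group
    _ = h * z * h⁻¹ * y := by rw [hcomm]; group

theorem card_centralizer_mul [Finite G] [N.Normal] (hc : CosetsConj N) {x : G} (hx : x ∈ N)
    (hx1 : x ≠ 1) :
    (Nat.card N - 1) * Nat.card (Subgroup.centralizer {x}) = Nat.card G := by
  rw [← card_isConj_mul_card_centralizer x]
  congr 1
  have : {y : G | IsConj x y} = (N : Set G) \ {1} := by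
    ext y
    refine ⟨fun h => ⟨?_, fun hy => hx1 ?_⟩, fun ⟨hy, hy1⟩ => hc.isConj_of_mem hx hy hx1 hy1⟩
    · obtain ⟨k, rfl⟩ := isConj_iff.1 h
      exact Subgroup.Normal.conj_mem ‹_› x hx k
    · rw [Set.mem_singleton_iff.1 hy] at h
      exact isConj_one_left.1 h
  rw [this, Nat.card_coe_set_eq, Set.ncard_sdiff_singleton_of_mem N.one_mem,
    ← Nat.card_coe_set_eq]
  rfl

/-- If g outside N has prime order r and commutes with x, then g * x is conjugate to g, so x ^ r = 1
and r = p. -/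
theorem isPGroup_centralizer [Finite G] (hc : CosetsConj N) {p : ℕ} (hp : p.Prime)
    (hpN : ∀ x ∈ N, x ^ p = 1)
    {x : G} (hx : x ∈ N) (hx1 : x ≠ 1) : IsPGroup p (Subgroup.centralizer {x}) := by
  have hxp : orderOf x = p := orderOf_eq_prime (hpN x hx) hx1 (hp := ⟨hp⟩)
  refine IsPGroup.of_card (Nat.eq_prime_pow_of_unique_prime_dvd Nat.card_pos.ne' ?_)
  intro r hr hrd
  have := Fact.mk hr
  obtain ⟨⟨g, hg⟩, hgr⟩ := exists_prime_orderOf_dvd_card' r hrd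
  rw [← Subgroup.orderOf_coe] at hgr
  change orderOf g = r at hgr
  have hgr' : g ^ r = 1 := by rw [← hgr, pow_orderOf_eq_one]
  by_cases hgN : g ∈ N
  · exact (Nat.prime_dvd_prime_iff_eq hr hp).1 (hgr ▸ orderOf_dvd_of_pow_eq_one (hpN g hgN))
  · obtain ⟨h, hh⟩ := isConj_iff.1 (hc.isConj_mul_of_notMem hgN hx)
    have hcomm : Commute g x := (Subgroup.mem_centralizer_singleton_iff.1 hg)
    have h1 : (g * x) ^ r = 1 := by rw [← hh, conj_pow, hgr']; simp
    rw [hcomm.mul_pow, hgr', one_mul] at h1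
    exact ((Nat.prime_dvd_prime_iff_eq hp hr).1 (hxp ▸ orderOf_dvd_of_pow_eq_one h1)).symm

theorem exists_card_mul_dvd_of_mem_centralizer [Finite G] [N.Normal] (hc : CosetsConj N)
    {p : ℕ} [Fact p.Prime]
    (hab : N ≤ Subgroup.centralizer N) (hC : IsPGroup p (Subgroup.centralizer (N : Set G)))
    {g : G} (hg : g ∈ Subgroup.centralizer (N : Set G)) (hgN : g ∉ N) :
    ∃ j, Nat.card N < p ^ j ∧ Nat.card N * p ^ j ∣ Nat.card G := by
  let M := Subgroup.centralizer {g} ⊓ Subgroup.centralizer (N : Set G)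
  obtain ⟨j, hj⟩ := IsPGroup.iff_card.1 (hC.to_le (inf_le_right : M ≤ _))
  have hNM : N < M := by
    refine lt_of_le_of_ne (le_inf (fun x hx => ?_) hab) fun h => hgN ?_
    · exact Subgroup.mem_centralizer_singleton_iff.2 ((Subgroup.mem_centralizer_iff.1 hg x hx))
    · rw [h]
      exact ⟨Subgroup.mem_centralizer_singleton_iff.2 rfl, hg⟩
  refine ⟨j, hj ▸ ?_, ?_⟩
  · exact Set.ncard_lt_ncard (SetLike.coe_ssubset_coe.2 hNM)
  · rw [← card_isConj_mul_card_centralizer g]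
    -- The class of g misses N, hence is a union of cosets of N; the other factor holds because M
    -- lies in the centralizer of g.
    refine mul_dvd_mul (card_dvd_card_of_forall_mul_mem fun y hy x hx => ?_)
      (hj ▸ Subgroup.card_dvd_of_le inf_le_left)
    refine IsConj.trans hy (hc.isConj_mul_of_notMem (fun hyN => hgN ?_) hx)
    obtain ⟨h, hh⟩ := isConj_iff.1 (IsConj.symm hy)
    exact hh ▸ Subgroup.Normal.conj_mem ‹_› y hyN h

end CosetsConj

end IsConjMulRight

/-! ### An involution inverting N. -/

section Inversion

variable {G : Type*} [Group G] {N : Subgroup G} {t : G}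

theorem eq_one_of_commute_of_inverts {p : ℕ} (hp : Odd p) (hpN : ∀ x ∈ N, x ^ p = 1)
    (hinv : ∀ x ∈ N, t * x = x⁻¹ * t) {x : G} (hx : x ∈ N) (hxt : Commute t x) : x = 1 := by
  have h : x = x⁻¹ := mul_right_cancel (hxt.eq.symm.trans (hinv x hx))
  have h2 : x ^ 2 = 1 := by
    rw [sq]
    nth_rw 1 [h]
    exact inv_mul_cancel x
  obtain ⟨r, rfl⟩ := hp
  simpa [pow_succ, pow_mul, h2] using hpN x hx

variable [N.Normal]

/-- The product of x and its conjugate by t is fixed by t, hence trivial. -/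
theorem conj_eq_inv_of_forall_notMem_centralizer (hab : N ≤ Subgroup.centralizer N)
    (ht : t * t = 1) (htN : ∀ x ∈ N, x ≠ 1 → t ∉ Subgroup.centralizer {x}) {x : G} (hx : x ∈ N) :
    t * x = x⁻¹ * t := by
  have htinv : t⁻¹ = t := inv_eq_of_mul_eq_one_left ht
  have hx' : t * x * t ∈ N := by
    simpa [htinv] using Subgroup.Normal.conj_mem ‹_› x hx t
  by_contra hne
  refine htN (x * (t * x * t)) (N.mul_mem hx hx') (fun h => hne ?_) ?_
  · rw [inv_eq_of_mul_eq_one_right h, mul_assoc, ht, mul_one]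
  · have hcomm := Subgroup.mem_centralizer_iff.1 (hab hx) _ hx'
    rw [Subgroup.mem_centralizer_singleton_iff]
    calc t * (x * (t * x * t)) = t * x * t * x * t := by simp only [mul_assoc]
      _ = x * (t * x * t) * t := by rw [hcomm]

/-- Inversion commutes with all automorphisms of N, so t * g * t * g⁻¹ centralizes N and lies in N:
t is central modulo N. -/
theorem exists_mul_commute_of_inverts {p : ℕ} (hp : Odd p) (hpN : ∀ x ∈ N, x ^ p = 1)
    (hCN : Subgroup.centralizer (N : Set G) ≤ N) (ht : t * t = 1)
    (hinv : ∀ x ∈ N, t * x = x⁻¹ * t) (g : G) : ∃ n ∈ N, Commute t (n * g) := by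
  have htinv : t⁻¹ = t := inv_eq_of_mul_eq_one_left ht
  have hy : t * g * t * g⁻¹ ∈ N := by
    refine hCN (Subgroup.mem_centralizer_iff.2 fun x hx => ?_)
    have hw : g⁻¹ * x * g ∈ N := by simpa using Subgroup.Normal.conj_mem ‹_› x hx g⁻¹
    have h1 := hinv _ hw
    calc x * (t * g * t * g⁻¹) = (x * t) * (g * t * g⁻¹) := by group
      _ = t * x⁻¹ * (g * t * g⁻¹) := by
        rw [show x * t = t * x⁻¹ by simpa using (hinv _ (N.inv_mem hx)).symm]
      _ = t * g * ((g⁻¹ * x * g)⁻¹ * t) * g⁻¹ := by group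
      _ = t * g * t * g⁻¹ * x := by rw [← h1]; group
  obtain ⟨r, hr⟩ := hp
  -- With p = 2r + 1, the power r + 1 is the square root of this element.
  refine ⟨(t * g * t * g⁻¹) ^ (r + 1), N.pow_mem hy _, ?_⟩
  have hpow := hpN _ hy
  have hn := hinv _ (N.pow_mem hy (r + 1))
  generalize hyy : t * g * t * g⁻¹ = y at *
  have htg : t * g = y * g * t := by
    rw [← hyy]
    simp [mul_assoc, ht]
  have hyr : (y ^ (r + 1))⁻¹ * y = y ^ (r + 1) := by
    rw [inv_mul_eq_iff_eq_mul, ← pow_add, show r + 1 + (r + 1) = 2 * r + 1 + 1 by ring, pow_succ,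
      ← hr, hpow, one_mul]
  calc t * (y ^ (r + 1) * g) = (t * y ^ (r + 1)) * g := by group
    _ = ((y ^ (r + 1))⁻¹ * y) * g * t := by rw [hn, mul_assoc, htg]; simp only [mul_assoc]
    _ = y ^ (r + 1) * g * t := by rw [hyr]

/-- Adjust g by N to f commuting with t and x. Each f * z with z in N is a conjugate of f by an
element of N, so counting makes z ↦ φ z a bijection of N. But x and 1 both fix f, so both come from
z = 1. -/
theorem CosetsConj.mem_of_mem_centralizer_of_inverts [Finite G] (hc : CosetsConj N)
    (hab : N ≤ Subgroup.centralizer N) {p : ℕ} (hp : Odd p) (hpN : ∀ x ∈ N, x ^ p = 1)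
    (hCN : Subgroup.centralizer (N : Set G) ≤ N) (ht : t * t = 1)
    (hinv : ∀ x ∈ N, t * x = x⁻¹ * t) {x g : G} (hx : x ∈ N) (hx1 : x ≠ 1)
    (hg : g ∈ Subgroup.centralizer {x}) : g ∈ N := by
  by_contra hgN
  obtain ⟨a, ha, hag⟩ := exists_mul_commute_of_inverts hp hpN hCN ht hinv g
  set f := a * g with hf
  have hfN : f ∉ N := fun h => hgN ((Subgroup.mul_mem_cancel_left N ha).1 h)
  have hfx : Commute f x := Commute.mul_left
    (Subgroup.mem_centralizer_iff.1 (hab ha) x hx).symm (Subgroup.mem_centralizer_singleton_iff.1 hg)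
  have hconj (z : N) : ∃ n : N, (n : G) * f * (n : G)⁻¹ = f * z := by
    obtain ⟨h, hh⟩ := isConj_iff.1 (hc.isConj_mul_of_notMem hfN z.2)
    obtain ⟨b, hb, hbh⟩ := exists_mul_commute_of_inverts hp hpN hCN ht hinv h
    refine ⟨⟨b⁻¹, N.inv_mem hb⟩, ?_⟩
    set c := b * h with hcdef
    have hhc : h = b⁻¹ * c := by simp [hcdef]
    have hw : f⁻¹ * (c * f * c⁻¹) ∈ N := by
      have e1 : f⁻¹ * (c * f * c⁻¹) = (f⁻¹ * b * f) * z * b⁻¹ := by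
        calc f⁻¹ * (c * f * c⁻¹) = f⁻¹ * b * (h * f * h⁻¹) * b⁻¹ := by rw [hcdef]; group
          _ = _ := by rw [hh]; group
      rw [e1]
      refine N.mul_mem (N.mul_mem ?_ z.2) (N.inv_mem hb)
      simpa using Subgroup.Normal.conj_mem ‹_› b hb f⁻¹
    -- c and f commute with t, while t fixes only 1 in N; hence c commutes with f, and b⁻¹ alone
    -- carries f to f * z.
    have hw1 := eq_one_of_commute_of_inverts hp hpN hinv hw
      (hag.inv_right.mul_right ((hbh.mul_right hag).mul_right hbh.inv_right))
    have hcf : c * f * c⁻¹ = f := (inv_mul_eq_one.1 hw1).symm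
    calc b⁻¹ * f * (b⁻¹)⁻¹ = h * f * h⁻¹ := by
          nth_rw 1 [← hcf]
          rw [hhc]
          group
      _ = f * z := hh
  choose φ hφ using hconj
  have hφinj : Function.Injective φ := fun z w h => by
    have := (hφ z).symm.trans ((congrArg (fun n : N => (n : G) * f * (n : G)⁻¹) h).trans (hφ w))
    exact Subtype.ext (mul_left_cancel this)
  have hφsurj := Finite.surjective_of_injective hφinj
  obtain ⟨z, hz⟩ := hφsurj ⟨x, hx⟩
  obtain ⟨w, hw⟩ := hφsurj 1
  have hz1 : (z : G) = 1 := by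
    have := hφ z
    rw [hz] at this
    simpa [← hfx.eq] using this.symm
  have hw1 : (w : G) = 1 := by
    have := hφ w
    rw [hw] at this
    simpa using this.symm
  have hzw : z = w := Subtype.ext (hz1.trans hw1.symm)
  rw [hzw, hw] at hz
  exact hx1 (congrArg Subtype.val hz).symm

end Inversion

/-! ### Assembling the arithmetic. -/

theorem mainTheorem10 {G : Type u} [Group G] [Finite G]
    (V : Type v) [AddCommGroup V] [Module ℂ V] [Module (MonoidAlgebra ℂ G) V]
    [IsScalarTower ℂ (MonoidAlgebra ℂ G) V] [IsSimpleModule (MonoidAlgebra ℂ G) V]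
    (d e : ℕ) (hd : Module.finrank ℂ V = d) (hn : Nat.card G = d * (d + e))
    (N : Subgroup G) (hNnormal : N.Normal) (hN : N ≠ ⊥)
    (hNV : ActsTriviallyOnOtherSimples N V)
    (he : 1 < e) (he2 : ∀ j : ℕ, e ≠ 2 ^ j) :
    ∃ p k m : ℕ, p.Prime ∧ Odd p ∧ 0 < k ∧ Nat.card N = p ^ k ∧ e = p ^ m ∧
      k < 2 * m ∧ Nat.card N < e ^ 2 := by
  have hGpos : 0 < Nat.card G := Nat.card_pos
  have hd0 : 0 < d := Nat.pos_of_ne_zero fun h => by simp [hn, h] at hGpos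
  have : FiniteDimensional ℂ V := Module.finite_of_finrank_pos (hd ▸ hd0)
  have hc : CosetsConj N := fun g x hg hx hgx => hNV.isConj_mul_right hg hx hgx
  have hcard := hNV.card_mul_eq hN
  rw [hd, hn] at hcard
  have hde : e * Nat.card N = d + e := by
    refine Nat.eq_of_mul_eq_mul_left hd0 ?_
    linarith
  obtain ⟨p, hp, hpN⟩ := hc.exists_prime_forall_pow_eq_one hN
  have := Fact.mk hp
  have hNp : IsPGroup p N := fun x => ⟨1, Subtype.ext (by simpa using hpN x x.2)⟩
  obtain ⟨k, hk⟩ := IsPGroup.iff_card.1 hNp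
  have hab := hc.le_centralizer_of_isPGroup hN hNp
  obtain ⟨⟨x, hx⟩, hx1'⟩ := Subgroup.ne_bot_iff_exists_ne_one.1 hN
  have hx1 : x ≠ 1 := fun h => hx1' (Subtype.ext h)
  have hq1 : 1 < p ^ k := by
    rw [← hk]
    exact (Subgroup.one_lt_card_iff_ne_bot N).2 hN
  have hk0 : 0 < k := Nat.pos_of_ne_zero fun h => by simp [h] at hq1
  have hd' : d = e * (p ^ k - 1) := by
    rw [Nat.mul_sub, mul_one, ← hk, hde, Nat.add_sub_cancel]
  have hG : Nat.card G = (p ^ k - 1) * (e ^ 2 * p ^ k) := by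
    rw [hn, ← hde, hk, hd']
    ring
  have hCx : Nat.card (Subgroup.centralizer {x}) = e ^ 2 * p ^ k := by
    refine Nat.eq_of_mul_eq_mul_left (Nat.sub_pos_of_lt hq1) ?_
    rw [← hG, ← hc.card_centralizer_mul hx hx1, hk]
  have hCxp := hc.isPGroup_centralizer hp hpN hx hx1
  obtain ⟨a, ha⟩ := IsPGroup.iff_card.1 hCxp
  have hea : e ∣ p ^ a := by
    rw [← ha, hCx, sq, mul_assoc]
    exact dvd_mul_right _ _
  obtain ⟨m, -, hem⟩ := (Nat.dvd_prime_pow hp).1 hea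
  have hpodd : Odd p := hp.odd_of_ne_two fun h => he2 m (h ▸ hem)
  suffices hkm : k < 2 * m by
    refine ⟨p, k, m, hp, hpodd, hk0, hk, hem, hkm, ?_⟩
    rw [hk, hem, ← pow_mul, mul_comm m]
    exact Nat.pow_lt_pow_right hp.one_lt hkm
  by_cases hCN : Subgroup.centralizer (N : Set G) ≤ N
  · exfalso
    have h2 : 2 ∣ Nat.card G := by
      rw [hG]
      exact (((hpodd.pow).tsub_odd odd_one).two_dvd).mul_right _
    obtain ⟨t, ht⟩ := exists_prime_orderOf_dvd_card' (hp := ⟨Nat.prime_two⟩) 2 h2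
    have htt : t * t = 1 := by rw [← sq, ← ht, pow_orderOf_eq_one]
    -- An element of order 2 cannot lie in a p-group with p odd.
    have htN : ∀ y ∈ N, y ≠ 1 → t ∉ Subgroup.centralizer {y} := fun y hy hy1 hty => by
      have hdvd := (hc.isPGroup_centralizer hp hpN hy hy1).dvd_orderOf
        (g := ⟨t, hty⟩) fun h => by
          rw [show t = 1 from congrArg Subtype.val h, orderOf_one] at ht
          omega
      rw [Subgroup.orderOf_mk, ht, Nat.prime_dvd_prime_iff_eq hp Nat.prime_two] at hdvd
      exact absurd hpodd (by rw [hdvd]; decide)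
    have hle : Subgroup.centralizer {x} ≤ N := fun g hg =>
      hc.mem_of_mem_centralizer_of_inverts hab hpodd hpN hCN htt
        (fun y hy => conj_eq_inv_of_forall_notMem_centralizer hab htt htN hy) hx hx1 hg
    have hcardle := Subgroup.card_le_of_le hle
    rw [hCx, hk] at hcardle
    nlinarith
  · obtain ⟨g, hg, hgN⟩ := SetLike.not_le_iff_exists.1 hCN
    have hC : IsPGroup p (Subgroup.centralizer (N : Set G)) :=
      hCxp.to_le (Subgroup.centralizer_le (Set.singleton_subset_iff.2 hx))
    obtain ⟨j, hj, hjG⟩ := hc.exists_card_mul_dvd_of_mem_centralizer hab hC hg hgN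
    rw [hk] at hj hjG
    have hkj : k < j := (Nat.pow_lt_pow_iff_right hp.one_lt).1 hj
    rw [hG, show (p ^ k - 1) * (e ^ 2 * p ^ k) = p ^ k * ((p ^ k - 1) * e ^ 2) by ring] at hjG
    have hjd := Nat.dvd_of_mul_dvd_mul_left (by omega) hjG
    -- Since p does not divide q - 1, the whole of p ^ j must divide e² = p ^ (2m).
    have hcop : Nat.Coprime (p ^ j) (p ^ k - 1) := by
      refine Nat.Coprime.pow_left j ((Nat.Prime.coprime_iff_not_dvd hp).2 fun h => hp.one_lt.ne' ?_)
      have := (Nat.dvd_sub_iff_right hq1.le (dvd_pow_self p hk0.ne')).1 h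
      exact Nat.dvd_one.1 this
    have hje := hcop.dvd_of_dvd_mul_left hjd
    rw [hem, ← pow_mul, Nat.pow_dvd_pow_iff_le_right hp.one_lt] at hje
    omega
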